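/- Let $\mathbb F$ be a field. A (left) Leibniz algebra over $\mathbb F$ is an $\mathbb F$-vector space with a bilinear multiplication satisfying $x(yz)=(xy)z+y(xz)$. For a Leibniz algebra $K$ let $Z(K)=\{z : zx=xz=0 \text{ for all } x\in K\}$ and let $K'$ be the linear span of all products $xy$ with $x,y\in K$. A defining pair for a Leibniz algebra $L$ is a pair $(K,N)$ with $N\subseteq Z(K)\cap K'$ a subalgebra and $K/N\cong L$. It is maximal if $\dim K$ is maximal among all defining pairs for $L$; then $K$ is called a cover of $L$ and $N$ the multiplier $M(L)$ of $L$ (unique up to isomorphism). Let $H^2(L,\mathbb F)=Z^2(L,\mathbb F)/B^2(L,\mathbb F)$, where $Z^2(L,\mathbb F)$ consists of the bilinear maps $f:L\times L\to\mathbb F$ with $f(i,jk)=f(ij,k)+f(j,ik)$ and $B^2(L,\mathbb F)$ of those of the form $f(i,j)=-\varepsilon(ij)$ with $\varepsilon:L\to\mathbb F$ linear. **Corollary.** Let $L$ be a finite-dimensional Leibniz algebra over $\mathbb F$, let $E$ be a cover of $L$, and let $A$ be a subalgebra of $E$ such that $A\subseteq Z(E)\cap E'$, $A\cong M(L)$ and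 $E/A\cong L$. For any surjective homomorphism $\pi:E\to L$ with kernel $A$, let $\mathrm{Tra}:\mathrm{Hom}(A,\mathbb F)\to H^2(L,\mathbb F)$ be the transgression map of the central extension $0\to A\to E\xrightarrow{\pi} L\to 0$. That is, $\mathrm{Hom}(A,\mathbb F)$ is the space of homomorphisms from $A$ to $\mathbb F$ with zero multiplication, and $\mathrm{Tra}(\chi)$ is the class of $(i,j)\mapsto\chi(\mu(i)\mu(j)-\mu(ij))$ for any linear map $\mu:L\to E$ with $\pi\circ\mu=\mathrm{id}_L$ (the class does not depend on $\mu$). Then $\mathrm{Tra}$ is bijective, and $H^2(L,\mathbb F)\cong M(L)$ as vector spaces. Thus, after identifying $H^2(L,\mathbb F)$ with $M(L)$, the map $\mathrm{Tra}:\mathrm{Hom}(A,\mathbb F)\to M(L)$ is bijective. -/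

import Mathlib

set_option maxSynthPendingDepth 3

universe u v w

/-- A (left) Leibniz algebra over `F`: an `F`-vector space with an `F`-bilinear multiplication
satisfying `x(yz) = (xy)z + y(xz)`. Bilinearity is distributivity (from
`NonUnitalNonAssocRing`) together with the two scalar compatibilities. -/
class LeibnizAlgebra (F : Type u) (L : Type v) [Field F] [NonUnitalNonAssocRing L]
    [Module F L] : Prop extends IsScalarTower F L L, SMulCommClass F L L where
  leibniz : ∀ x y z : L, x * (y * z) = (x * y) * z + y * (x * z)

namespace Leibniz

section Basic

variable (F : Type u) [Field F]
variable (L : Type v) [NonUnitalNonAssocRing L] [Module F L] [LeibnizAlgebra F L]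

/-- The center `Z(L)` of a Leibniz algebra: all `z` with `zx = xz = 0` for every `x`. -/
def center : Submodule F L where
  carrier := {z | ∀ x : L, z * x = 0 ∧ x * z = 0}
  add_mem' := by
    intro a b ha hb x
    simp [add_mul, mul_add, ha x, hb x]
  zero_mem' := by
    intro x
    simp
  smul_mem' := by
    intro c a ha x
    simp [smul_mul_assoc, mul_smul_comm, ha x]

/-- The derived algebra `L' = LL`, the linear span of all products. -/
def derived : Submodule F L :=
  Submodule.span F {z | ∃ x y : L, z = x * y}

/-- `Hom(L, F)`: Leibniz algebra homomorphisms from `L` to the abelian algebra `F` (the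
one-dimensional space with zero product), that is, linear forms that kill all products. -/
def homToField : Submodule F (Module.Dual F L) where
  carrier := {χ | ∀ x y : L, χ (x * y) = 0}
  add_mem' := by
    intro a b ha hb x y
    simp [ha x y, hb x y]
  zero_mem' := by
    intro x y
    simp
  smul_mem' := by
    intro c a ha x y
    simp [ha x y]

end Basic

section Isomorphism

variable (F : Type*) [Field F]

/-- The Leibniz algebras `A` and `B` are isomorphic. -/
def Isomorphic (A B : Type*) [NonUnitalNonAssocRing A] [Module F A]
    [NonUnitalNonAssocRing B] [Module F B] : Prop :=
  ∃ e : A ≃ₗ[F] B, ∀ x y : A, e (x * y) = e x * e y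

/-- `0 → A → E → L → 0` is exact, `A` being a subalgebra of `E` and the first map the inclusion.
Such a `π` is the same as an isomorphism `E/A ≅ L`. -/
structure IsExtension {F : Type*} [Field F] {E L : Type*}
    [NonUnitalNonAssocRing E] [Module F E] [NonUnitalNonAssocRing L] [Module F L]
    (A : NonUnitalSubalgebra F E) (π : E →ₙₐ[F] L) : Prop where
  surjective : Function.Surjective π
  ker_eq : ∀ x : E, π x = 0 ↔ x ∈ A

end Isomorphism

section Cover

variable (F : Type u) [Field F]
variable (L : Type v) [NonUnitalNonAssocRing L] [Module F L] [LeibnizAlgebra F L]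

/-- `(K, N)` is a defining pair for `L`: `N ⊆ Z(K) ∩ K'` and `K/N ≅ L`. -/
def IsDefiningPair (K : Type*) [NonUnitalNonAssocRing K] [Module F K] [LeibnizAlgebra F K]
    (N : NonUnitalSubalgebra F K) : Prop :=
  N.toSubmodule ≤ center F K ⊓ derived F K ∧ ∃ π : K →ₙₐ[F] L, IsExtension N π

/-- `(K, N)` is a defining pair for `L` with `dim K` maximal among all defining pairs. -/
def IsMaximalDefiningPair (K : Type (max u v)) [NonUnitalNonAssocRing K] [Module F K]
    [LeibnizAlgebra F K] (N : NonUnitalSubalgebra F K) : Prop :=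
  IsDefiningPair F L K N ∧
    ∀ (J : Type (max u v)) [NonUnitalNonAssocRing J] [Module F J] [LeibnizAlgebra F J]
      (P : NonUnitalSubalgebra F J), IsDefiningPair F L J P →
      Module.rank F J ≤ Module.rank F K

/-- `K` is a cover of `L`: the first member of a maximal defining pair. -/
def IsCover (K : Type (max u v)) [NonUnitalNonAssocRing K] [Module F K]
    [LeibnizAlgebra F K] : Prop :=
  ∃ N : NonUnitalSubalgebra F K, IsMaximalDefiningPair F L K N

/-- `M` is (isomorphic to) the multiplier `M(L)` of `L`: the second member of a maximal
defining pair. -/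
def IsMultiplier (M : Type w) [NonUnitalNonAssocRing M] [Module F M]
    [LeibnizAlgebra F M] : Prop :=
  ∃ (K : Type (max u v)) (_ : NonUnitalNonAssocRing K) (_ : Module F K)
    (_ : LeibnizAlgebra F K) (N : NonUnitalSubalgebra F K),
    IsMaximalDefiningPair F L K N ∧ Isomorphic F M N

end Cover

section Cohomology

variable (F : Type*) [Field F]
variable (L : Type*) [NonUnitalNonAssocRing L] [Module F L] [LeibnizAlgebra F L]
variable (V : Type*) [AddCommGroup V] [Module F V]

/-- The 2-cocycles `Z²(L, V)` with values in the central `L`-module `V`: bilinear `f` with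
`f(i, jk) = f(ij, k) + f(j, ik)`. -/
def cocycles₂ : Submodule F (L →ₗ[F] L →ₗ[F] V) where
  carrier := {f | ∀ i j k : L, f i (j * k) = f (i * j) k + f j (i * k)}
  add_mem' := by
    intro f g hf hg i j k
    simp only [LinearMap.add_apply, hf i j k, hg i j k]
    abel
  zero_mem' := by
    intro i j k
    simp
  smul_mem' := by
    intro c f hf i j k
    simp only [LinearMap.smul_apply, hf i j k, smul_add]

/-- The 2-coboundaries `B²(L, V)`: cocycles `f` with `f(i, j) = -ε(ij)` for a linear
`ε : L → V`. -/
def coboundaries₂ : Submodule F (cocycles₂ F L V) where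
  carrier := {f | ∃ ε : L →ₗ[F] V, ∀ i j : L, f.1 i j = -ε (i * j)}
  add_mem' := by
    rintro f g ⟨ε, hε⟩ ⟨δ, hδ⟩
    refine ⟨ε + δ, fun i j => ?_⟩
    simp only [Submodule.coe_add, LinearMap.add_apply, hε i j, hδ i j]
    abel
  zero_mem' := ⟨0, fun i j => by simp⟩
  smul_mem' := by
    rintro c f ⟨ε, hε⟩
    refine ⟨c • ε, fun i j => ?_⟩
    simp only [Submodule.coe_smul, LinearMap.smul_apply, hε i j, smul_neg]

/-- The second cohomology group `H²(L, V) = Z²(L, V) / B²(L, V)`. -/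
abbrev H2 : Type _ := cocycles₂ F L V ⧸ coboundaries₂ F L V

end Cohomology

section Transgression

variable {F : Type*} [Field F]
variable {L : Type*} [NonUnitalNonAssocRing L] [Module F L] [LeibnizAlgebra F L]
variable {E : Type*} [NonUnitalNonAssocRing E] [Module F E] [LeibnizAlgebra F E]
variable {A : NonUnitalSubalgebra F E} {π : E →ₙₐ[F] L}

/-- The bilinear map `f(i, j) = μ(i)μ(j) - μ(ij)` from `L × L` to `A` attached to a linear
section `μ` of the extension `0 → A → E → L → 0`. -/
def factorSet (hπ : IsExtension A π) (μ : L →ₗ[F] E) (hμ : ∀ x, π (μ x) = x) :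
    L →ₗ[F] L →ₗ[F] A :=
  LinearMap.mk₂ F
    (fun i j => ⟨μ i * μ j - μ (i * j), (hπ.ker_eq _).1 (by simp [hμ])⟩)
    (fun i i' j => Subtype.ext <| by
      simp only [map_add, add_mul, NonUnitalSubalgebra.coe_add]
      abel)
    (fun c i j => Subtype.ext <| by
      simp only [map_smul, smul_mul_assoc, smul_sub, NonUnitalSubalgebra.coe_smul])
    (fun i j j' => Subtype.ext <| by
      simp only [map_add, mul_add, NonUnitalSubalgebra.coe_add]
      abel)
    (fun c i j => Subtype.ext <| by
      simp only [map_smul, mul_smul_comm, smul_sub, NonUnitalSubalgebra.coe_smul])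

theorem factorSet_mem_cocycles₂ (hπ : IsExtension A π) (hA : A.toSubmodule ≤ center F E)
    (μ : L →ₗ[F] E) (hμ : ∀ x, π (μ x) = x) :
    factorSet hπ μ hμ ∈ cocycles₂ F L A := by
  have hl : ∀ (x : E) (i j : L), x * (μ i * μ j) = x * μ (i * j) := by
    intro x i j
    have h := (hA (factorSet hπ μ hμ i j).2 x).2
    change x * (μ i * μ j - μ (i * j)) = 0 at h
    rwa [mul_sub, sub_eq_zero] at h
  have hr : ∀ (x : E) (i j : L), (μ i * μ j) * x = μ (i * j) * x := by
    intro x i j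
    have h := (hA (factorSet hπ μ hμ i j).2 x).1
    change (μ i * μ j - μ (i * j)) * x = 0 at h
    rwa [sub_mul, sub_eq_zero] at h
  intro i j k
  apply Subtype.ext
  change μ i * μ (j * k) - μ (i * (j * k))
    = (μ (i * j) * μ k - μ ((i * j) * k)) + (μ j * μ (i * k) - μ (j * (i * k)))
  rw [← hl, ← hl, ← hr, LeibnizAlgebra.leibniz (F := F) (μ i),
    LeibnizAlgebra.leibniz (F := F) i, map_add]
  abel

/-- The transgression map `Tra : Hom(A, F) → H²(L, F)`, `Tra(χ) = [χ ∘ f]`, of the central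
extension `0 → A → E → L → 0`, where `f(i, j) = μ(i)μ(j) - μ(ij)` for a linear section `μ`. -/
def transgression (hπ : IsExtension A π) (hA : A.toSubmodule ≤ center F E)
    (μ : L →ₗ[F] E) (hμ : ∀ x, π (μ x) = x) :
    homToField F A →ₗ[F] H2 F L F where
  toFun χ := Submodule.Quotient.mk
    ⟨(factorSet hπ μ hμ).compr₂ χ.1, fun i j k => by
      simp only [LinearMap.compr₂_apply]
      rw [factorSet_mem_cocycles₂ hπ hA μ hμ i j k, map_add]⟩
  map_add' χ ψ := rfl
  map_smul' c χ := rfl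

/-- The transgression map does not depend on the section. -/
theorem transgression_eq (hπ : IsExtension A π) (hA : A.toSubmodule ≤ center F E)
    (μ : L →ₗ[F] E) (hμ : ∀ x, π (μ x) = x) (ν : L →ₗ[F] E) (hν : ∀ x, π (ν x) = x) :
    transgression hπ hA μ hμ = transgression hπ hA ν hν := by
  have hmem : ∀ x, (μ - ν) x ∈ A.toSubmodule := fun x =>
    (hπ.ker_eq _).1 (by simp [hμ, hν])
  ext χ
  refine (Submodule.Quotient.eq _).2
    ⟨χ.1.comp ((μ - ν).codRestrict A.toSubmodule hmem), fun i j => ?_⟩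
  change χ.1 (factorSet hπ μ hμ i j) - χ.1 (factorSet hπ ν hν i j) = -χ.1 ⟨(μ - ν) (i * j), _⟩
  rw [← map_sub, ← map_neg]
  congr 1
  apply Subtype.ext
  change μ i * μ j - μ (i * j) - (ν i * ν j - ν (i * j)) = -(μ (i * j) - ν (i * j))
  have h1 : (μ i - ν i) * μ j = 0 := (hA (hmem i) (μ j)).1
  have h2 : ν i * (μ j - ν j) = 0 := (hA (hmem j) (ν i)).2
  rw [sub_mul, sub_eq_zero] at h1
  rw [mul_sub, sub_eq_zero] at h2
  rw [h1, h2]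
  abel

end Transgression

end Leibniz

/-! The proof compares dimensions. Since `A` is central and lies in the derived algebra of `E`,
`Tra` is injective (`transgression_injective`), so dim A ≤ dim H². This needs no maximality. For the
reverse inequality, a linear choice of representatives of the classes in H² is a single cocycle with
values in the dual of H². The central extension it defines is a defining pair of dimension dim L +
dim H² (`exists_isDefiningPair`), so maximality of dim E = dim A + dim L gives dim H² ≤ dim A. An
injection between spaces of equal finite dimension is bijective. -/

namespace Leibniz

/-! ### Central extensions built from cocycles -/

section CocycleExtension

variable {F : Type*} [Field F]
variable {L : Type*} [NonUnitalNonAssocRing L] [Module F L]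
variable {V : Type*} [AddCommGroup V] [Module F V]

/-- The central extension of `L` by `V` attached to a 2-cocycle `f`: the vector space `L × V` with
the product `(i, a)(j, b) = (ij, f(i, j))`. -/
def CocycleExtension (_f : cocycles₂ F L V) : Type _ := L × V

namespace CocycleExtension

variable (f : cocycles₂ F L V)

instance : AddCommGroup (CocycleExtension f) := inferInstanceAs (AddCommGroup (L × V))

instance : Module F (CocycleExtension f) := inferInstanceAs (Module F (L × V))

instance : Mul (CocycleExtension f) where
  mul x y := (x.1 * y.1, f.1 x.1 y.1)

/-- The underlying vector space of the extension is `L × V`. -/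
def equivProd : CocycleExtension f ≃ₗ[F] L × V := LinearEquiv.refl F (L × V)

variable {f}

theorem equivProd_mul (x y : CocycleExtension f) :
    equivProd f (x * y) = ((equivProd f x).1 * (equivProd f y).1,
      f.1 (equivProd f x).1 (equivProd f y).1) := rfl

instance : NonUnitalNonAssocRing (CocycleExtension f) where
  left_distrib x y z := (equivProd f).injective <| by
    simp [equivProd_mul, mul_add]
  right_distrib x y z := (equivProd f).injective <| by
    simp [equivProd_mul, add_mul]
  zero_mul x := (equivProd f).injective <| by
    simp [equivProd_mul]
  mul_zero x := (equivProd f).injective <| by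
    simp [equivProd_mul]

/-- The `V`-component of the Leibniz identity is exactly the cocycle condition on `f`. -/
instance [LeibnizAlgebra F L] : LeibnizAlgebra F (CocycleExtension f) where
  smul_assoc c x y := (equivProd f).injective <| by
    simp [equivProd_mul, smul_mul_assoc]
  smul_comm c x y := (equivProd f).injective <| by
    simp [equivProd_mul, mul_smul_comm]
  leibniz x y z := (equivProd f).injective <| by
    simp only [map_add, equivProd_mul, Prod.mk_add_mk]
    exact Prod.ext (LeibnizAlgebra.leibniz (F := F) _ _ _) (f.2 _ _ _)

variable (f)

/-- The projection of the extension attached to a cocycle onto the base. -/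
def proj : CocycleExtension f →ₙₐ[F] L where
  toFun x := (equivProd f x).1
  map_smul' c x := by simp
  map_zero' := by simp
  map_add' x y := by simp
  map_mul' x y := by simp [equivProd_mul]

/-- The kernel of the extension attached to a cocycle. -/
def kernel : NonUnitalSubalgebra F (CocycleExtension f) where
  carrier := {x | (equivProd f x).1 = 0}
  add_mem' {x y} hx hy := by
    simp only [Set.mem_ofPred_eq] at hx hy ⊢
    simp [hx, hy]
  zero_mem' := by simp
  mul_mem' {x y} hx hy := by
    simp only [Set.mem_ofPred_eq] at hx hy ⊢
    simp [equivProd_mul, hx]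
  smul_mem' c x hx := by
    simp only [Set.mem_ofPred_eq] at hx ⊢
    simp [hx]

theorem isExtension : IsExtension (kernel f) (proj f) where
  surjective i := ⟨(equivProd f).symm (i, 0),
    congrArg Prod.fst ((equivProd f).apply_symm_apply (i, 0))⟩
  ker_eq _ := Iff.rfl

theorem kernel_le_center [LeibnizAlgebra F L] :
    (kernel f).toSubmodule ≤ center F (CocycleExtension f) := by
  intro x hx y
  have hx' : (equivProd f x).1 = 0 := hx
  constructor <;> apply (equivProd f).injective <;> simp [equivProd_mul, hx']

/-- The kernel of the extension lies in the derived algebra as soon as no nonzero linear form on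
it maps the cocycle to a coboundary. -/
theorem kernel_le_derived [LeibnizAlgebra F L]
    (hf : ∀ (ψ : Module.Dual F V) (ε : L →ₗ[F] F), (∀ i j, ψ (f.1 i j) = -ε (i * j)) → ψ = 0) :
    (kernel f).toSubmodule ≤ derived F (CocycleExtension f) := by
  intro x hx
  have hx' : (equivProd f x).1 = 0 := hx
  by_contra hxd
  -- A linear form separates `x` from the derived algebra. As it kills (i, 0)(j, 0) = (ij, f(i, j)),
  -- its restrictions ψ to `V` and ε to `L` satisfy ψ(f(i, j)) = -ε(ij), so ψ = 0 by `hf`.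
  obtain ⟨φ, hφx, hφ⟩ := Submodule.exists_le_ker_of_notMem hxd
  set φ' := φ ∘ₗ (equivProd f).symm.toLinearMap
  have hψ : φ' ∘ₗ LinearMap.inr F L V = 0 := by
    refine hf _ (φ' ∘ₗ LinearMap.inl F L V) fun i j => ?_
    have h : φ ((equivProd f).symm (i, 0) * (equivProd f).symm (j, 0)) = 0 :=
      hφ (Submodule.subset_span ⟨_, _, rfl⟩)
    have h' : (equivProd f).symm (i, 0) * (equivProd f).symm (j, 0)
        = (equivProd f).symm (i * j, f.1 i j) := (equivProd f).injective <| by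
      simp [equivProd_mul]
    rw [eq_neg_iff_add_eq_zero]
    simp only [LinearMap.comp_apply, ← map_add, LinearMap.inr_apply, LinearMap.inl_apply,
      Prod.mk_add_mk, zero_add, add_zero]
    rw [h'] at h
    exact h
  apply hφx
  have h := LinearMap.congr_fun hψ (equivProd f x).2
  have hx2 : (equivProd f).symm (0, (equivProd f x).2) = x := by
    rw [LinearEquiv.symm_apply_eq]
    exact Prod.ext hx'.symm rfl
  simpa [φ', hx2] using h

end CocycleExtension

end CocycleExtension

/-! ### The universal cocycle and a large defining pair -/

section Universal

variable (F : Type*) [Field F]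
variable (L : Type*) [NonUnitalNonAssocRing L] [Module F L]

/-- There is a 2-cocycle of `L` with values in the dual of `H²(L, F)` whose evaluation at each
class `h` represents `h`. -/
theorem exists_universal_cocycle :
    ∃ f : cocycles₂ F L (Module.Dual F (H2 F L F)), ∀ h : H2 F L F,
      ∃ g : cocycles₂ F L F, Submodule.Quotient.mk g = h ∧ ∀ i j, f.1 i j h = g.1 i j := by
  -- The representatives must be chosen linearly, so that h ↦ s(h)(i, j) is a linear form on H².
  obtain ⟨s, hs⟩ := (coboundaries₂ F L F).mkQ.exists_rightInverse_of_surjective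
    (Submodule.range_mkQ _)
  let t : H2 F L F →ₗ[F] L →ₗ[F] L →ₗ[F] F := (cocycles₂ F L F).subtype ∘ₗ s
  let f : L →ₗ[F] L →ₗ[F] Module.Dual F (H2 F L F) :=
    LinearMap.mk₂ F (fun i j => (LinearMap.applyₗ j) ∘ₗ (LinearMap.applyₗ i) ∘ₗ t)
      (fun i i' j => by ext h; simp) (fun c i j => by ext h; simp)
      (fun i j j' => by ext h; simp) (fun c i j => by ext h; simp)
  have hf : ∀ i j h, f i j h = (s h).1 i j := fun _ _ _ => rfl
  refine ⟨⟨f, fun i j k => LinearMap.ext fun h => ?_⟩, fun h => ⟨s h, ?_, fun i j => hf i j h⟩⟩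
  · rw [LinearMap.add_apply, hf, hf, hf]
    exact (s h).2 i j k
  · exact LinearMap.congr_fun hs h

/-- `L` has a defining pair of dimension `dim L + dim H²(L, F)`. -/
theorem exists_isDefiningPair (F : Type u) [Field F]
    (L : Type v) [NonUnitalNonAssocRing L] [Module F L] [LeibnizAlgebra F L]
    [FiniteDimensional F L] :
    ∃ (J : Type (max u v)) (_ : NonUnitalNonAssocRing J) (_ : Module F J)
      (_ : LeibnizAlgebra F J) (P : NonUnitalSubalgebra F J), IsDefiningPair F L J P ∧
        Nonempty (J ≃ₗ[F] L × Module.Dual F (H2 F L F)) := by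
  obtain ⟨f, hf⟩ := exists_universal_cocycle F L
  refine ⟨CocycleExtension f, inferInstance, inferInstance, inferInstance,
    CocycleExtension.kernel f,
    ⟨le_inf (CocycleExtension.kernel_le_center f) (CocycleExtension.kernel_le_derived f ?_),
      _, CocycleExtension.isExtension f⟩, ⟨CocycleExtension.equivProd f⟩⟩
  intro ψ ε hψ
  -- H² is finite-dimensional, so ψ is evaluation at a class `h`. It turns the universal cocycle
  -- into a representative of `h`; if that is a coboundary, then h = 0.
  obtain ⟨h, rfl⟩ := (Module.evalEquiv F (H2 F L F)).surjective ψ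
  obtain ⟨g, rfl, hg⟩ := hf h
  rw [(Submodule.Quotient.mk_eq_zero _).2 (show g ∈ coboundaries₂ F L F from
    ⟨ε, fun i j => by rw [← hg, ← hψ]; rfl⟩), map_zero]

end Universal

/-! ### Injectivity of the transgression -/

section Transgression

variable {F : Type*} [Field F]
variable {L : Type*} [NonUnitalNonAssocRing L] [Module F L]
variable {E : Type*} [NonUnitalNonAssocRing E] [Module F E]
variable {A : NonUnitalSubalgebra F E} {π : E →ₙₐ[F] L}

/-- The total space of an extension is the direct sum of base and kernel. -/
theorem IsExtension.nonempty_equiv_prod (hπ : IsExtension A π) :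
    Nonempty (E ≃ₗ[F] A × L) := by
  have hker : LinearMap.ker (π : E →ₗ[F] L) = A.toSubmodule := by
    ext x
    exact hπ.ker_eq x
  obtain ⟨C, hC⟩ := A.toSubmodule.exists_isCompl
  have e1 := Submodule.quotEquivOfEq _ _ hker
  have e2 := (π : E →ₗ[F] L).quotKerEquivOfSurjective hπ.surjective
  exact ⟨(Submodule.prodEquivOfIsCompl _ C hC).symm ≪≫ₗ
    (LinearEquiv.refl F A).prodCongr
      ((Submodule.quotientEquivOfIsCompl _ C hC).symm ≪≫ₗ e1.symm ≪≫ₗ e2)⟩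

variable [LeibnizAlgebra F L] [LeibnizAlgebra F E]

/-- Every linear form on a central subalgebra is a homomorphism to `F`. -/
theorem homToField_eq_top (hA : A.toSubmodule ≤ center F E) : homToField F A = ⊤ := by
  refine eq_top_iff.2 fun χ _ x y => ?_
  have h : x * y = 0 := Subtype.ext (hA x.2 y).1
  rw [h, map_zero]

/-- If χ ∘ f is the coboundary of ε, then φ(x) = χ(x - μ(π x)) + ε(π x) kills every product in `E`,
hence the derived algebra and with it `A`. On `A` the form φ is χ, so χ = 0. -/
theorem transgression_injective (hπ : IsExtension A π)
    (hA : A.toSubmodule ≤ center F E) (hA' : A.toSubmodule ≤ derived F E)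
    (μ : L →ₗ[F] E) (hμ : ∀ x, π (μ x) = x) :
    Function.Injective (transgression hπ hA μ hμ) := by
  rw [injective_iff_map_eq_zero]
  intro χ hχ
  obtain ⟨ε, hε⟩ := (Submodule.Quotient.mk_eq_zero _).1 hχ
  let p : E →ₗ[F] L := (π : E →ₗ[F] L)
  have hp : ∀ x, p x = π x := fun _ => rfl
  have hmem : ∀ x, (LinearMap.id - μ ∘ₗ p : E →ₗ[F] E) x ∈ A.toSubmodule := fun x =>
    (hπ.ker_eq _).1 (by simp [hp, hμ])
  let r : E →ₗ[F] A.toSubmodule :=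
    (LinearMap.id - μ ∘ₗ p : E →ₗ[F] E).codRestrict A.toSubmodule hmem
  let φ : E →ₗ[F] F := χ.1 ∘ₗ r + ε ∘ₗ p
  have hφ : derived F E ≤ LinearMap.ker φ := by
    refine Submodule.span_le.2 ?_
    rintro _ ⟨x, y, rfl⟩
    have h : χ.1 (factorSet hπ μ hμ (π x) (π y)) = -ε (π x * π y) := hε (π x) (π y)
    -- Modulo central elements each factor is its lift, so xy = μ(π x)μ(π y).
    have h1 : (x - μ (π x)) * y = 0 := (hA (hmem x) y).1
    have h2 : μ (π x) * (y - μ (π y)) = 0 := (hA (hmem y) (μ (π x))).2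
    rw [sub_mul, sub_eq_zero] at h1
    rw [mul_sub, sub_eq_zero] at h2
    have h3 : r (x * y)
        = factorSet hπ μ hμ (π x) (π y) := by
      apply Subtype.ext
      change x * y - μ (π (x * y)) = μ (π x) * μ (π y) - μ (π x * π y)
      rw [map_mul, h1, h2]
    change χ.1 (r (x * y))
      + ε (π (x * y)) = 0
    rw [h3, h, map_mul π, neg_add_cancel]
  refine Subtype.ext (LinearMap.ext fun a => ?_)
  have h0 : π a.1 = 0 := (hπ.ker_eq _).2 a.2
  have h4 : r a.1 = a := by
    apply Subtype.ext
    change a.1 - μ (π a.1) = a.1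
    rw [h0, map_zero, sub_zero]
  have h5 : χ.1 (r a.1) + ε (π a.1) = 0 :=
    hφ (hA' a.2)
  rw [h4, h0, map_zero, add_zero] at h5
  exact h5

end Transgression

end Leibniz

/-! ### The dimension count -/

open Leibniz in
theorem mainTheorem9 {F : Type u} [Field F]
    {L : Type v} [NonUnitalNonAssocRing L] [Module F L] [LeibnizAlgebra F L]
    [FiniteDimensional F L]
    {E : Type (max u v)} [NonUnitalNonAssocRing E] [Module F E] [LeibnizAlgebra F E]
    (hE : Leibniz.IsCover F L E)
    {M : Type w} [NonUnitalNonAssocRing M] [Module F M] [LeibnizAlgebra F M]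
    (hM : Leibniz.IsMultiplier F L M)
    (A : NonUnitalSubalgebra F E)
    (hA : A.toSubmodule ≤ Leibniz.center F E ⊓ Leibniz.derived F E)
    (hAM : Leibniz.Isomorphic F A M)
    (π : E →ₙₐ[F] L) (hπ : Leibniz.IsExtension A π)
    (μ : L →ₗ[F] E) (hμ : ∀ x, π (μ x) = x) :
    Function.Bijective (Leibniz.transgression hπ (hA.trans inf_le_left) μ hμ) ∧
      Nonempty (Leibniz.H2 F L F ≃ₗ[F] M) := by
  have hAc := hA.trans inf_le_left
  have hinj := transgression_injective hπ hAc (hA.trans inf_le_right) μ hμ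
  let e : homToField F A ≃ₗ[F] Module.Dual F A :=
    LinearEquiv.ofTop _ (homToField_eq_top hAc)
  -- Finiteness of `E` is not a hypothesis: it passes from H² through `Tra` to the dual of `A`, then
  -- to `A` and to `E`.
  have : FiniteDimensional F (homToField F A) := FiniteDimensional.of_injective _ hinj
  have : FiniteDimensional F (Module.Dual F A) := e.finiteDimensional
  have : FiniteDimensional F A := (Module.finite_dual_iff F).1 this
  have hdual : Module.finrank F (homToField F A) = Module.finrank F A :=
    e.finrank_eq.trans Subspace.dual_finrank_eq
  have hle : Module.finrank F (homToField F A) ≤ Module.finrank F (H2 F L F) :=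
    LinearMap.finrank_le_finrank_of_injective hinj
  obtain ⟨eE⟩ := hπ.nonempty_equiv_prod
  obtain ⟨J, _, _, _, P, hP, ⟨eJ⟩⟩ := exists_isDefiningPair F L
  -- Only the maximality of dim E matters, so `A` need not equal `N`.
  obtain ⟨N, -, hmax⟩ := hE
  have : FiniteDimensional F E := eE.symm.finiteDimensional
  have hJ : Module.finrank F J ≤ Module.finrank F E :=
    Module.finrank_le_finrank_of_rank_le_rank (by simpa using hmax J P hP)
      (Module.rank_lt_aleph0 F E)
  -- Now dim L + dim H² ≤ dim A + dim L, and dim L cancels.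
  rw [eJ.finrank_eq, eE.finrank_eq, Module.finrank_prod, Module.finrank_prod,
    Subspace.dual_finrank_eq] at hJ
  have heq : Module.finrank F (homToField F A) = Module.finrank F (H2 F L F) := by omega
  obtain ⟨eM, -⟩ := hAM
  exact ⟨⟨hinj, (LinearMap.injective_iff_surjective_of_finrank_eq_finrank heq).1 hinj⟩,
    ⟨LinearEquiv.ofFinrankEq _ _ (heq.symm.trans hdual) ≪≫ₗ eM⟩⟩
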